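/- For a positive integer $m$ let $d(m)$ denote the number of positive divisors of $m$, and let $\log$ be the natural logarithm. Then for every integer $N \ge 2$, $$\sum_{n=2}^{N} d(n^2-1) \;\le\; 4N\left(\frac{3}{\pi^{2}}\log^{2} N + 1.3949\,\log N + 0.4107 + 3.253\,N^{-1/3}\right),$$ where $\log^2 N = (\log N)^2$. -/

import Mathlib

/-!
Divisors of `n ^ 2 - 1` come in pairs with product `n ^ 2 - 1`, and each pair has a member below
`n`, so `d(n ^ 2 - 1)` is at most twice the number of divisors `d < n`. Summing over `n` and
exchanging the order of summation, one counts for each `d ≤ N` the `n ∈ (d, N]` with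
`n ^ 2 ≡ 1 (mod d)`; there are at most `ρ(d) N / d` of these, `ρ(d)` being the number of square
roots of `1` modulo `d` (`sum_card_divisors_sq_sub_one_le`).

By the Chinese remainder theorem `ρ(d)` is the product of its value at the `2`-part of `d`, which is
at most `4`, and its value at the odd part, which is at most the number of odd divisors `τ'(d)`
(`card_unitRoots_le`). Since `τ'` ignores factors `2`, the `2`-parts contribute a factor
`1 + 1/4 + 2/8 = 3/2` to `∑ ρ(d) / d` (`sum_card_unitRoots_div_le`). Finally
`∑_{d ≤ N} τ'(d) / d` is the sum over odd `a ≤ N` of `1 / a` times a harmonic sum of length `N / a`,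
which is at most `L ^ 2 / 4 + 3 L / 2 + 1` with `L = log N` (`sum_card_oddDivisors_div_le`).

Altogether the sum is at most `2 N (3 L ^ 2 / 8 + 9 L / 4 + 3 / 2)`. The leading coefficient `3 / 8`
is below the required `6 / π ^ 2` already because `π ≤ 4`, so the restriction to squarefree odd `a`,
which would give the true order `3 / π ^ 2`, is not needed.
-/

/-! ### Square roots of one modulo an integer -/

/-- The square roots of `1` modulo `d`, represented by residues in `[0, d)`. -/
def unitRoots (d : ℕ) : Finset ℕ := {x ∈ Finset.range d | x ^ 2 ≡ 1 [MOD d]}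

/-- The odd divisors of `d`. -/
def oddDivisors (d : ℕ) : Finset ℕ := {a ∈ d.divisors | Odd a}

lemma modEq_one_iff_dvd_int (d x : ℕ) :
    x ^ 2 ≡ 1 [MOD d] ↔ (d : ℤ) ∣ ((x : ℤ) + 1) * ((x : ℤ) - 1) := by
  rw [show x ^ 2 ≡ 1 [MOD d] ↔ 1 ≡ x ^ 2 [MOD d] from ⟨.symm, .symm⟩, Nat.modEq_iff_dvd]
  push_cast
  ring_nf

lemma card_unitRoots_mul_le {a b : ℕ} (hab : a.Coprime b) (ha : 0 < a) (hb : 0 < b) :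
    (unitRoots (a * b)).card ≤ (unitRoots a).card * (unitRoots b).card := by
  rw [← Finset.card_product]
  apply Finset.card_le_card_of_injOn (fun x ↦ (x % a, x % b))
  · intro x hx
    simp only [unitRoots, Finset.coe_filter, Finset.mem_range, Set.mem_ofPred_eq] at hx
    simp only [unitRoots, Finset.coe_product, Set.mem_prod, Finset.coe_filter, Finset.mem_range,
      Set.mem_ofPred_eq]
    exact ⟨⟨Nat.mod_lt _ ha, ((Nat.mod_modEq x a).pow 2).trans (hx.2.of_mul_right b)⟩,
      ⟨Nat.mod_lt _ hb, ((Nat.mod_modEq x b).pow 2).trans (hx.2.of_mul_left a)⟩⟩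
  · intro x hx y hy hxy
    simp only [unitRoots, Finset.coe_filter, Finset.mem_range, Set.mem_ofPred_eq] at hx hy
    simp only [Prod.mk.injEq] at hxy
    exact Nat.ModEq.eq_of_lt_of_lt ((Nat.modEq_and_modEq_iff_modEq_mul hab).1 hxy) hx.1 hy.1

/-- For odd `m` a root `x` is determined by `a = gcd (x + 1, m)`: it is `-1` modulo `a` and `1`
modulo `m / a`, and these two moduli are coprime. -/
lemma card_unitRoots_le_of_odd {m : ℕ} (hm : Odd m) :
    (unitRoots m).card ≤ m.divisors.card := by
  have hm0 : m ≠ 0 := by rintro rfl; simp at hm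
  have key : ∀ x ∈ unitRoots m, ∃ b : ℕ, m = Nat.gcd (x + 1) m * b ∧ (b : ℤ) ∣ (x : ℤ) - 1 ∧
      (Nat.gcd (x + 1) m).Coprime b := by
    intro x hx
    simp only [unitRoots, Finset.mem_filter, modEq_one_iff_dvd_int] at hx
    have hpos : 0 < Nat.gcd (x + 1) m := Nat.gcd_pos_of_pos_left _ (by omega)
    obtain ⟨u, v, huv, hu, hv⟩ := Nat.exists_coprime (x + 1) m
    have hb : (v : ℤ) ∣ (x : ℤ) - 1 := by
      have h := hx.2
      have hu' : ((x : ℤ) + 1) = u * (Nat.gcd (x + 1) m : ℕ) := by exact_mod_cast hu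
      have hv' : (m : ℤ) = v * (Nat.gcd (x + 1) m : ℕ) := by exact_mod_cast hv
      rw [hu', hv', mul_right_comm] at h
      have h2 := Int.dvd_of_mul_dvd_mul_right (by exact_mod_cast hpos.ne') h
      exact (Int.isCoprime_iff_gcd_eq_one.2 (by simpa using huv.symm)).dvd_of_dvd_mul_left h2
    refine ⟨v, by rw [mul_comm]; exact hv, hb, ?_⟩
    apply Nat.Coprime.symm
    rw [Nat.coprime_iff_isRelPrime]
    intro c hc1 hc2
    have h1 : (c : ℤ) ∣ (x : ℤ) + 1 := by
      exact_mod_cast hc2.trans (Nat.gcd_dvd_left (x + 1) m)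
    have h2 : (c : ℤ) ∣ (x : ℤ) - 1 := (Int.natCast_dvd_natCast.2 hc1).trans hb
    have h3 : (c : ℤ) ∣ 2 := by have := dvd_sub h1 h2; ring_nf at this; exact this
    have h4 : c ∣ 2 := by exact_mod_cast h3
    have h5 : c ∣ m := hc2.trans (Nat.gcd_dvd_right _ _)
    have h6 : Nat.Coprime 2 m := Nat.coprime_two_left.2 hm
    exact Nat.isUnit_iff.2 (Nat.dvd_one.1 (h6 ▸ Nat.dvd_gcd h4 h5))
  apply Finset.card_le_card_of_injOn (fun x ↦ Nat.gcd (x + 1) m)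
  · intro x _
    simp [Nat.gcd_dvd_right, hm0]
  · intro x hx y hy hxy
    obtain ⟨b, hb, hbx, hcop⟩ := key x hx
    obtain ⟨c, hc, hcy, -⟩ := key y hy
    simp only at hxy
    have hpos : 0 < Nat.gcd (x + 1) m := Nat.gcd_pos_of_pos_left _ (by omega)
    have hbc : b = c := Nat.eq_of_mul_eq_mul_left hpos (by rw [← hb, hxy, ← hc])
    subst hbc
    have h1 : x + 1 ≡ y + 1 [MOD Nat.gcd (x + 1) m] :=
      ((Nat.modEq_zero_iff_dvd).2 (Nat.gcd_dvd_left _ _)).trans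
        ((Nat.modEq_zero_iff_dvd).2 (hxy ▸ Nat.gcd_dvd_left (y + 1) m)).symm
    have h2 : x ≡ y [MOD b] := by
      rw [Nat.modEq_iff_dvd]
      have := dvd_sub hcy hbx
      simpa using this
    have h3 := (Nat.modEq_and_modEq_iff_modEq_mul hcop).1 ⟨Nat.ModEq.add_right_cancel' 1 h1, h2⟩
    rw [← hb] at h3
    simp only [unitRoots, Finset.coe_filter, Finset.mem_range, Set.mem_ofPred_eq] at hx hy
    exact Nat.ModEq.eq_of_lt_of_lt h3 hx.1 hy.1

/-- Of the two neighbours `x ± 1` of an odd `x`, one is `2` modulo `4`, so the other carries all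
but one of the factors `2`; hence `x` is `±1` modulo `2 ^ k`. -/
lemma card_unitRoots_two_pow_le (k : ℕ) : (unitRoots (2 ^ (k + 1))).card ≤ 4 := by
  have hsub : unitRoots (2 ^ (k + 1)) ⊆ {1, 2 ^ k + 1, 2 ^ k - 1, 2 * 2 ^ k - 1} := by
    intro x hx
    simp only [unitRoots, Finset.mem_filter, Finset.mem_range, modEq_one_iff_dvd_int] at hx
    obtain ⟨hlt, hdvd⟩ := hx
    have hodd : x % 2 = 1 := by
      have h2 : (2 : ℤ) ∣ ((x : ℤ) + 1) * ((x : ℤ) - 1) :=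
        (by rw [pow_succ]; push_cast; exact Dvd.intro_left _ rfl :
          (2 : ℤ) ∣ ((2 ^ (k + 1) : ℕ) : ℤ)).trans hdvd
      rcases Int.prime_two.dvd_or_dvd h2 with h | h <;> omega
    have hodd' : 1 ≤ x := by omega
    have hN : 2 ^ (k + 1) ∣ (x + 1) * (x - 1) := by
      zify [hodd']
      exact_mod_cast hdvd
    have hk : 0 < 2 ^ k := by positivity
    have hcase : 2 ^ k ∣ x + 1 ∨ 2 ^ k ∣ x - 1 := by
      obtain ⟨t, ht⟩ : ∃ t, x = 2 * t + 1 := ⟨x / 2, by omega⟩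
      subst ht
      rw [show 2 * t + 1 + 1 = 2 * (t + 1) by ring, show 2 * t + 1 - 1 = 2 * t by omega] at *
      rcases Nat.even_or_odd t with ht | ht
      · right
        have hc : Nat.Coprime (2 ^ k) (t + 1) :=
          Nat.Coprime.pow_left _ (Nat.coprime_two_left.2 ht.add_one)
        rw [pow_succ, show 2 * (t + 1) * (2 * t) = (t + 1) * (2 * t) * 2 by ring] at hN
        exact hc.dvd_of_dvd_mul_left (Nat.dvd_of_mul_dvd_mul_right (by norm_num) hN)
      · left
        have hc : Nat.Coprime (2 ^ k) t := Nat.Coprime.pow_left _ (Nat.coprime_two_left.2 ht)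
        rw [pow_succ, show 2 * (t + 1) * (2 * t) = t * (2 * (t + 1)) * 2 by ring] at hN
        exact hc.dvd_of_dvd_mul_left (Nat.dvd_of_mul_dvd_mul_right (by norm_num) hN)
    rw [pow_succ] at hlt
    simp only [Finset.mem_insert, Finset.mem_singleton]
    rcases hcase with ⟨c, hc⟩ | ⟨c, hc⟩
    · have : c ≤ 2 := by
        by_contra! h
        have := Nat.mul_le_mul_left (2 ^ k) (show 3 ≤ c by omega)
        omega
      interval_cases c <;> omega
    · have : c ≤ 1 := by
        by_contra! h
        have := Nat.mul_le_mul_left (2 ^ k) (show 2 ≤ c by omega)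
        omega
      interval_cases c <;> omega
  exact (Finset.card_le_card hsub).trans Finset.card_le_four

lemma oddDivisors_two_pow_mul (k e : ℕ) : oddDivisors (2 ^ k * e) = oddDivisors e := by
  ext a
  simp only [oddDivisors, Finset.mem_filter, Nat.mem_divisors, ne_eq, mul_eq_zero, pow_eq_zero_iff',
    OfNat.ofNat_ne_zero, false_and, false_or, and_congr_left_iff, and_congr_left_iff]
  intro ha _
  exact ((Nat.coprime_two_right.2 ha).pow_right k).dvd_mul_left

lemma oddDivisors_of_odd {m : ℕ} (hm : Odd m) : oddDivisors m = m.divisors :=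
  Finset.filter_true_of_mem fun _ ha ↦ hm.of_dvd_nat (Nat.dvd_of_mem_divisors ha)

/-- The factor in front bounds the number of square roots of `1` modulo the
`2`-part of `d`: it is `1, 1, 2, 4, 4, …` for the `2`-parts `1, 2, 4, 8, 16, …`. -/
lemma card_unitRoots_le {d : ℕ} (hd : d ≠ 0) :
    (unitRoots d).card ≤
      (1 + (if 4 ∣ d then 1 else 0) + (if 8 ∣ d then 2 else 0)) * (oddDivisors d).card := by
  obtain ⟨k, m, hm2, rfl⟩ := Nat.exists_eq_two_pow_mul_odd hd
  rw [oddDivisors_two_pow_mul, oddDivisors_of_odd hm2]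
  have hcop : Nat.Coprime (2 ^ k) m := Nat.Coprime.pow_left _ (Nat.coprime_two_left.2 hm2)
  refine (card_unitRoots_mul_le hcop (by positivity) hm2.pos).trans
    (Nat.mul_le_mul ?_ (card_unitRoots_le_of_odd hm2))
  rcases k with _ | _ | _ | k
  · exact (show (unitRoots (2 ^ 0)).card ≤ 1 by decide).trans (by omega)
  · exact (show (unitRoots (2 ^ 1)).card ≤ 1 by decide).trans (by omega)
  · rw [if_pos ((show 4 ∣ 2 ^ 2 by norm_num).mul_right m)]
    exact (show (unitRoots (2 ^ 2)).card ≤ 2 by decide).trans (by omega)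
  · have h8 : 8 ∣ 2 ^ (k + 3) * m := ((pow_dvd_pow 2 (by omega) : 2 ^ 3 ∣ 2 ^ (k + 3))).mul_right m
    rw [if_pos h8, if_pos ((show 4 ∣ 8 by norm_num).trans h8)]
    exact card_unitRoots_two_pow_le (k + 2)

/-! ### From divisors of `n ^ 2 - 1` to square roots of one -/

lemma card_divisors_sq_sub_one_le {n : ℕ} (hn : 2 ≤ n) :
    (n ^ 2 - 1).divisors.card ≤ 2 * {d ∈ Finset.Ico 1 n | d ∣ n ^ 2 - 1}.card := by
  have hsq : 2 * 2 ≤ n ^ 2 := by rw [sq]; exact Nat.mul_le_mul hn hn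
  have h0 : n ^ 2 - 1 ≠ 0 := by omega
  have hsplit : ((n ^ 2 - 1).divisors.filter (· < n)).card +
      ((n ^ 2 - 1).divisors.filter (¬ · < n)).card = (n ^ 2 - 1).divisors.card :=
    Finset.card_filter_add_card_filter_not _
  rw [← hsplit, two_mul]
  apply add_le_add
  · apply Finset.card_le_card
    intro d hd
    simp only [Finset.mem_filter, Finset.mem_Ico, Nat.mem_divisors] at hd ⊢
    exact ⟨⟨Nat.pos_of_dvd_of_pos hd.1.1 (by omega), hd.2⟩, hd.1.1⟩
  -- a divisor `d ≥ n` is matched with its cofactor, which is below `n`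
  · apply Finset.card_le_card_of_injOn (fun d ↦ (n ^ 2 - 1) / d)
    · intro d hd
      simp only [Finset.coe_filter, Set.mem_ofPred_eq, Nat.mem_divisors, not_lt, Finset.mem_Ico]
        at hd ⊢
      obtain ⟨⟨hdvd, -⟩, hnd⟩ := hd
      refine ⟨⟨Nat.div_pos (Nat.le_of_dvd (by omega) hdvd) (by omega), ?_⟩,
        Nat.div_dvd_of_dvd hdvd⟩
      rw [Nat.div_lt_iff_lt_mul (by omega)]
      have : n ^ 2 ≤ n * d := by rw [sq]; exact Nat.mul_le_mul_left n hnd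
      omega
    · intro d hd e he hde
      simp only [Finset.coe_filter, Set.mem_ofPred_eq, Nat.mem_divisors] at hd he
      simp only at hde
      rw [← Nat.div_div_self hd.1.1 h0, ← Nat.div_div_self he.1.1 h0, hde]

/-- Writing `n = q d + r`, the multiplier `q` lies in `[1, N / d]` because `d < n ≤ N`. -/
lemma card_filter_dvd_sq_sub_one_le {d N : ℕ} (hd : 0 < d) :
    {n ∈ Finset.Ioc d N | d ∣ n ^ 2 - 1}.card ≤ (unitRoots d).card * (N / d) := by
  rw [show N / d = (Finset.Icc 1 (N / d)).card by simp, ← Finset.card_product]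
  apply Finset.card_le_card_of_injOn (fun n ↦ (n % d, n / d))
  · intro n hn
    simp only [Finset.coe_filter, Set.mem_ofPred_eq, Finset.mem_Ioc] at hn
    simp only [unitRoots, Finset.coe_product, Set.mem_prod, Finset.coe_filter, Finset.mem_range,
      Set.mem_ofPred_eq, Finset.coe_Icc, Set.mem_Icc]
    refine ⟨⟨Nat.mod_lt _ hd, ((Nat.mod_modEq n d).pow 2).trans ?_⟩,
      Nat.div_pos hn.1.1.le hd, Nat.div_le_div_right hn.1.2⟩
    exact ((Nat.modEq_iff_dvd' (Nat.one_le_pow _ _ (by omega))).2 hn.2).symm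
  · intro x _ y _ hxy
    simp only [Prod.mk.injEq] at hxy
    rw [← Nat.mod_add_div x d, hxy.1, hxy.2, Nat.mod_add_div]

lemma sum_card_filter_dvd_comm (N : ℕ) :
    ∑ n ∈ Finset.Icc 2 N, {d ∈ Finset.Ico 1 n | d ∣ n ^ 2 - 1}.card =
      ∑ d ∈ Finset.Icc 1 N, {n ∈ Finset.Ioc d N | d ∣ n ^ 2 - 1}.card := by
  simp only [Finset.card_eq_sum_ones]
  refine Finset.sum_comm' fun n d ↦ ?_
  simp only [Finset.mem_filter, Finset.mem_Icc, Finset.mem_Ico, Finset.mem_Ioc]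
  have h1 : 1 ≤ d ∧ d < n → 2 ≤ n := by omega
  have h2 : d < n ∧ n ≤ N → d ≤ N := by omega
  tauto

lemma sum_card_divisors_sq_sub_one_le (N : ℕ) :
    ∑ n ∈ Finset.Icc 2 N, ((n ^ 2 - 1).divisors.card : ℝ) ≤
      2 * N * ∑ d ∈ Finset.Icc 1 N, ((unitRoots d).card : ℝ) / d := by
  have h1 : ∑ n ∈ Finset.Icc 2 N, (n ^ 2 - 1).divisors.card ≤
      2 * ∑ d ∈ Finset.Icc 1 N, (unitRoots d).card * (N / d) := by
    refine (Finset.sum_le_sum fun n hn ↦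
      card_divisors_sq_sub_one_le (Finset.mem_Icc.1 hn).1).trans ?_
    rw [← Finset.mul_sum, sum_card_filter_dvd_comm]
    refine Nat.mul_le_mul_left 2 (Finset.sum_le_sum fun d hd ↦ ?_)
    exact card_filter_dvd_sq_sub_one_le (Finset.mem_Icc.1 hd).1
  calc ∑ n ∈ Finset.Icc 2 N, ((n ^ 2 - 1).divisors.card : ℝ)
      ≤ 2 * ∑ d ∈ Finset.Icc 1 N, ((unitRoots d).card : ℝ) * ((N / d : ℕ) : ℝ) := by
        exact_mod_cast h1
    _ ≤ 2 * ∑ d ∈ Finset.Icc 1 N, ((unitRoots d).card : ℝ) * ((N : ℝ) / d) := by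
        refine mul_le_mul_of_nonneg_left (Finset.sum_le_sum fun d _ ↦ ?_) zero_le_two
        exact mul_le_mul_of_nonneg_left Nat.cast_div_le (Nat.cast_nonneg _)
    _ = _ := by
        rw [mul_assoc, Finset.mul_sum _ _ (N : ℝ)]
        exact congrArg (2 * ·) (Finset.sum_congr rfl fun d _ ↦ by ring)

/-! ### Removing the powers of two -/

lemma sum_Icc_ite_dvd {c : ℕ} (hc : 0 < c) (N : ℕ) (f : ℕ → ℝ) :
    ∑ d ∈ Finset.Icc 1 N, (if c ∣ d then f d else 0) =
      ∑ e ∈ Finset.Icc 1 (N / c), f (c * e) := by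
  rw [← Finset.sum_filter]
  symm
  apply Finset.sum_nbij (fun e ↦ c * e)
  · intro e he
    simp only [Finset.mem_Icc, Finset.mem_filter] at he ⊢
    refine ⟨⟨Nat.mul_pos hc he.1, ?_⟩, dvd_mul_right c e⟩
    rw [mul_comm]
    exact (Nat.le_div_iff_mul_le hc).1 he.2
  · intro x _ y _ hxy
    exact Nat.eq_of_mul_eq_mul_left hc hxy
  · intro d hd
    simp only [Finset.coe_filter, Finset.mem_Icc, Set.mem_ofPred_eq] at hd
    obtain ⟨⟨h1, h2⟩, e, rfl⟩ := hd
    refine ⟨e, ?_, rfl⟩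
    simp only [Finset.coe_Icc, Set.mem_Icc]
    exact ⟨Nat.pos_of_mul_pos_left h1, (Nat.le_div_iff_mul_le hc).2 (by rwa [mul_comm])⟩
  · simp

lemma sum_card_oddDivisors_div_ite_le (k N : ℕ) :
    ∑ d ∈ Finset.Icc 1 N, (if 2 ^ k ∣ d then ((oddDivisors d).card : ℝ) / d else 0) ≤
      (1 / 2 ^ k) * ∑ d ∈ Finset.Icc 1 N, ((oddDivisors d).card : ℝ) / d := by
  rw [sum_Icc_ite_dvd (by positivity), Finset.mul_sum]
  calc ∑ e ∈ Finset.Icc 1 (N / 2 ^ k), ((oddDivisors (2 ^ k * e)).card : ℝ) / ((2 ^ k * e : ℕ) : ℝ)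
      = ∑ e ∈ Finset.Icc 1 (N / 2 ^ k), (1 / 2 ^ k) * (((oddDivisors e).card : ℝ) / e) := by
        refine Finset.sum_congr rfl fun e _ ↦ ?_
        rw [oddDivisors_two_pow_mul]
        push_cast
        rw [div_mul_div_comm, one_mul]
    _ ≤ _ := Finset.sum_le_sum_of_subset_of_nonneg
        (Finset.Icc_subset_Icc_right (Nat.div_le_self _ _)) fun _ _ _ ↦ by positivity

lemma sum_card_unitRoots_div_le (N : ℕ) :
    ∑ d ∈ Finset.Icc 1 N, ((unitRoots d).card : ℝ) / d ≤
      3 / 2 * ∑ d ∈ Finset.Icc 1 N, ((oddDivisors d).card : ℝ) / d := by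
  have h4 := sum_card_oddDivisors_div_ite_le 2 N
  have h8 := sum_card_oddDivisors_div_ite_le 3 N
  norm_num at h4 h8
  calc ∑ d ∈ Finset.Icc 1 N, ((unitRoots d).card : ℝ) / d
      ≤ ∑ d ∈ Finset.Icc 1 N, (((oddDivisors d).card : ℝ) / d
          + (if 4 ∣ d then ((oddDivisors d).card : ℝ) / d else 0)
          + 2 * (if 8 ∣ d then ((oddDivisors d).card : ℝ) / d else 0)) := by
        refine Finset.sum_le_sum fun d hd ↦ ?_
        have hd0 : d ≠ 0 := by have := (Finset.mem_Icc.1 hd).1; omega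
        have h : ((unitRoots d).card : ℝ) ≤
            (1 + (if 4 ∣ d then 1 else 0) + (if 8 ∣ d then 2 else 0)) * (oddDivisors d).card := by
          exact_mod_cast card_unitRoots_le hd0
        calc ((unitRoots d).card : ℝ) / d ≤ _ := div_le_div_of_nonneg_right h (Nat.cast_nonneg d)
          _ = _ := by split_ifs <;> ring
    _ ≤ _ := by
        rw [Finset.sum_add_distrib, Finset.sum_add_distrib, ← Finset.mul_sum]
        linarith

/-! ### The logarithmic sum over odd divisors -/

lemma sum_Icc_mul_inv_le {a N : ℕ} (ha : 1 ≤ a) (haN : a ≤ N) :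
    ∑ e ∈ Finset.Icc 1 (N / a), (1 : ℝ) / ((a * e : ℕ) : ℝ) ≤
      (1 + Real.log ((N : ℝ) / a)) / a := by
  have hx : (1 : ℝ) ≤ (N : ℝ) / a := by
    rw [one_le_div (by exact_mod_cast ha)]
    exact_mod_cast haN
  have h := harmonic_floor_le_one_add_log ((N : ℝ) / a) hx
  rw [Nat.floor_div_natCast, Nat.floor_natCast, harmonic_eq_sum_Icc] at h
  push_cast at h
  calc ∑ e ∈ Finset.Icc 1 (N / a), (1 : ℝ) / ((a * e : ℕ) : ℝ)
      = (∑ e ∈ Finset.Icc 1 (N / a), ((e : ℝ))⁻¹) / a := by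
        rw [Finset.sum_div]
        refine Finset.sum_congr rfl fun e _ ↦ ?_
        push_cast
        rw [one_div, mul_inv, div_eq_mul_inv, mul_comm]
    _ ≤ _ := div_le_div_of_nonneg_right h (Nat.cast_nonneg a)

/-- Comparison of the sum over odd `a = 2 j + 1` with half of the integral
`∫ (1 + log (x / t)) / t dt` over `[1, 2 k + 1]`, in telescoping form. -/
lemma sum_range_odd_log_le (x : ℝ) (k : ℕ) (hk : (2 * k + 1 : ℝ) ≤ x) :
    ∑ j ∈ Finset.range (k + 1), (1 + Real.log (x / (2 * j + 1))) / (2 * j + 1) ≤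
      1 + Real.log x + (Real.log x ^ 2 - Real.log (x / (2 * k + 1)) ^ 2) / 4
        + (Real.log x - Real.log (x / (2 * k + 1))) / 2 := by
  induction k with
  | zero => simp
  | succ k ih =>
    push_cast at hk
    have hk0 : (0 : ℝ) ≤ k := Nat.cast_nonneg k
    have hx : 0 < x := by linarith
    rw [Finset.sum_range_succ]
    have ih := ih (by linarith)
    push_cast
    set u := Real.log (x / (2 * k + 1)) with hu
    set v := Real.log (x / (2 * ((k : ℝ) + 1) + 1)) with hv
    have hv0 : 0 ≤ v := Real.log_nonneg (by rw [le_div_iff₀ (by positivity)]; linarith)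
    -- `log t ≥ 1 - 1 / t` at `t = (2 k + 3) / (2 k + 1)`
    have huv : 2 / (2 * ((k : ℝ) + 1) + 1) ≤ u - v := by
      rw [hu, hv, ← Real.log_div (by positivity) (by positivity)]
      refine le_trans (le_of_eq ?_) (Real.one_sub_inv_le_log_of_pos (by positivity))
      field_simp
      ring
    set s := 2 * ((k : ℝ) + 1) + 1
    have hs : 0 < s := by positivity
    have h1 : (1 + v) / s = 2 / s * (1 / 2 + v / 2) := by field_simp
    have h2 : 2 / s * (1 / 2 + v / 2) ≤ (u - v) * (1 / 2 + v / 2) := by gcongr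
    nlinarith [sq_nonneg (u - v)]

lemma sum_card_oddDivisors_div_le {N : ℕ} (hN : 1 ≤ N) :
    ∑ d ∈ Finset.Icc 1 N, ((oddDivisors d).card : ℝ) / d ≤
      Real.log N ^ 2 / 4 + 3 / 2 * Real.log N + 1 := by
  calc ∑ d ∈ Finset.Icc 1 N, ((oddDivisors d).card : ℝ) / d
      = ∑ a ∈ Finset.Icc 1 N with Odd a,
          ∑ d ∈ Finset.Icc 1 N, (if a ∣ d then (1 : ℝ) / d else 0) := by
        simp_rw [← Finset.sum_filter, div_eq_mul_inv, ← nsmul_eq_mul, ← Finset.sum_const, one_mul]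
        apply Finset.sum_comm'
        intro d a
        simp only [oddDivisors, Finset.mem_filter, Finset.mem_Icc, Nat.mem_divisors]
        constructor
        · rintro ⟨⟨h1, h2⟩, ⟨h3, h4⟩, h5⟩
          exact ⟨⟨⟨h1, h2⟩, h3⟩, ⟨Nat.pos_of_dvd_of_pos h3 h1,
            (Nat.le_of_dvd h1 h3).trans h2⟩, h5⟩
        · rintro ⟨⟨⟨h1, h2⟩, h3⟩, -, h5⟩
          exact ⟨⟨h1, h2⟩, ⟨h3, by omega⟩, h5⟩
    _ ≤ ∑ a ∈ Finset.Icc 1 N with Odd a, (1 + Real.log ((N : ℝ) / a)) / a := by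
        refine Finset.sum_le_sum fun a ha ↦ ?_
        simp only [Finset.mem_filter, Finset.mem_Icc] at ha
        rw [sum_Icc_ite_dvd ha.1.1 N fun d ↦ (1 : ℝ) / d]
        exact sum_Icc_mul_inv_le ha.1.1 ha.1.2
    _ = ∑ j ∈ Finset.range ((N - 1) / 2 + 1),
          (1 + Real.log ((N : ℝ) / (2 * j + 1))) / (2 * j + 1) := by
        symm
        apply Finset.sum_nbij (fun j ↦ 2 * j + 1)
        · intro j hj
          simp only [Finset.mem_range, Finset.mem_filter, Finset.mem_Icc] at hj ⊢
          exact ⟨by omega, j, rfl⟩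
        · intro i _ j _ hij
          simp only at hij
          omega
        · rintro a ha
          simp only [Finset.coe_filter, Finset.mem_Icc, Set.mem_ofPred_eq] at ha
          obtain ⟨h, j, rfl⟩ := ha
          refine ⟨j, ?_, rfl⟩
          simp only [Finset.coe_range, Set.mem_Iio]
          omega
        · intro j _
          push_cast
          rfl
    _ ≤ _ := by
        have hk : (2 * ((N - 1) / 2 : ℕ) + 1 : ℝ) ≤ N := by
          exact_mod_cast (show 2 * ((N - 1) / 2) + 1 ≤ N by omega)
        refine (sum_range_odd_log_le N _ hk).trans ?_
        have hv0 : 0 ≤ Real.log ((N : ℝ) / (2 * ((N - 1) / 2 : ℕ) + 1)) :=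
          Real.log_nonneg (by rw [le_div_iff₀ (by positivity)]; linarith)
        nlinarith

/-! ### The bound for the divisor sum -/

theorem mainTheorem8 (N : ℕ) (hN : 2 ≤ N) :
    (∑ n ∈ Finset.Icc 2 N, ((n ^ 2 - 1).divisors.card : ℝ)) ≤
      4 * (N : ℝ) * (3 * Real.pi⁻¹ ^ 2 * Real.log (N : ℝ) ^ 2 + 1.3949 * Real.log (N : ℝ)
        + 0.4107 + 3.253 * (N : ℝ) ^ (-(1 / 3) : ℝ)) := by
  have hN0 : (0 : ℝ) < N := by exact_mod_cast (show 0 < N by omega)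
  have hL : 0 ≤ Real.log (N : ℝ) := Real.log_natCast_nonneg N
  have hsum := sum_card_unitRoots_div_le N
  have hF := sum_card_oddDivisors_div_le (show 1 ≤ N by omega)
  have hpi : (1 / 4 : ℝ) ^ 2 ≤ Real.pi⁻¹ ^ 2 := by
    have : (1 / 4 : ℝ) ≤ Real.pi⁻¹ := by
      rw [one_div]
      exact inv_anti₀ Real.pi_pos Real.pi_le_four
    gcongr
  have hpiL := mul_le_mul_of_nonneg_right hpi (sq_nonneg (Real.log (N : ℝ)))
  have hpow0 : 0 ≤ (N : ℝ) ^ (-(1 / 3) : ℝ) := by positivity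
  have hpow : 1 - Real.log N / 3 ≤ (N : ℝ) ^ (-(1 / 3) : ℝ) := by
    rw [Real.rpow_def_of_pos hN0]
    linarith [Real.add_one_le_exp (Real.log (N : ℝ) * (-(1 / 3)))]
  refine (sum_card_divisors_sq_sub_one_le N).trans ?_
  rw [show (4 : ℝ) * N = 2 * N * 2 by ring, mul_assoc (2 * (N : ℝ)) 2]
  refine mul_le_mul_of_nonneg_left ?_ (by positivity)
  -- the constant term is paid for by `log N` when `N` is large
  -- and by `N ^ (-1 / 3)` when it is small
  rcases le_total (Real.log (N : ℝ)) (3 / 2) with h | h <;> nlinarith
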